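/- Let $K$ be a field. All functors are covariant functors on the category of commutative $K$-algebras. A functor of $\mathcal K$-modules is a functor $\mathbb M$ such that each $\mathbb M(S)$ is an $S$-module and addition $\mathbb M\times\mathbb M\to\mathbb M$ and scalar multiplication $\mathcal K\times\mathbb M\to\mathbb M$ are natural in $S$, where $\mathcal K(S):=S$; a morphism of such functors is a natural transformation whose components are $S$-linear. Kernels, quotients and inverse limits are computed objectwise. Let $\mathbb M^*$ be the functor of $\mathcal K$-modules with $\mathbb M^*(S):=\operatorname{Hom}_{\mathcal S}(\mathbb M_{|S},\mathcal S)$, where $\mathbb M_{|S}$ and $\mathcal S=\mathcal K_{|S}$ are the restrictions of $\mathbb M$ and $\mathcal K$ to commutative $S$-algebras. $\mathbb M$ is reflexive if the natural morphism $\mathbb M\to\mathbb M^{**}$, $m\mapsto (w\mapsto w(m))$, is an isomorphism. A functor of $\mathcal K$-modules is quasi-coherent if it is isomorphic to $\mathcal V$, $\mathcal V(S):=V\otimes_K S$, for some $K$-vector space $V$. A quasi-coherent quotient of $\mathbb M$ is a quotient $\mathbb M/\mathbb N$ by a functor of submodules $\mathbb N\subseteq\mathbb M$ that is quasi-coherent;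 the quasi-coherent quotients form an inverse system, with the natural projections $\mathbb M/\mathbb N\to\mathbb M/\mathbb N'$ for $\mathbb N\subseteq\mathbb N'$. A functor of $\mathcal K$-modules is proquasi-coherent if it is isomorphic to the inverse limit of an inverse system of quasi-coherent modules indexed by a directed set. **Theorem.** Let $\mathbb M$ be a functor of $\mathcal K$-modules. Then $\mathbb M$ is reflexive if and only if $\mathbb M$ is the inverse limit of its quasi-coherent quotients, that is, the natural morphism $$\mathbb M\longrightarrow \varprojlim_{\mathbb M/\mathbb N \text{ quasi-coherent}} \mathbb M/\mathbb N$$ is an isomorphism. In particular, every reflexive functor of $\mathcal K$-modules is proquasi-coherent. -/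

import Mathlib

open scoped TensorProduct

universe u v w

/-- A functor of `𝓡`-modules: a covariant functor `S ↦ M(S)` on commutative `R`-algebras, where
each `M(S)` is an `S`-module and addition and scalar multiplication are natural in `S`. -/
structure ModuleFunctor (R : Type u) [CommRing R] where
  obj : ∀ (S : Type u) [CommRing S] [Algebra R S], Type v
  [addCommGroup : ∀ (S : Type u) [CommRing S] [Algebra R S], AddCommGroup (obj S)]
  [module : ∀ (S : Type u) [CommRing S] [Algebra R S], Module S (obj S)]
  map : ∀ {S T : Type u} [CommRing S] [Algebra R S] [CommRing T] [Algebra R T],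
    (S →ₐ[R] T) → (obj S →+ obj T)
  map_smul : ∀ {S T : Type u} [CommRing S] [Algebra R S] [CommRing T] [Algebra R T]
    (f : S →ₐ[R] T) (s : S) (m : obj S), map f (s • m) = f s • map f m
  map_id : ∀ {S : Type u} [CommRing S] [Algebra R S] (m : obj S), map (AlgHom.id R S) m = m
  map_comp : ∀ {S T T' : Type u} [CommRing S] [Algebra R S] [CommRing T] [Algebra R T]
    [CommRing T'] [Algebra R T'] (g : T →ₐ[R] T') (f : S →ₐ[R] T) (m : obj S),
    map (g.comp f) m = map g (map f m)

namespace ModuleFunctor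

attribute [instance] ModuleFunctor.addCommGroup ModuleFunctor.module

variable {R : Type u} [CommRing R]

/-- A morphism of functors of `𝓡`-modules. -/
@[ext]
structure Hom (M : ModuleFunctor.{u, v} R) (N : ModuleFunctor.{u, w} R) where
  app : ∀ (S : Type u) [CommRing S] [Algebra R S], M.obj S →ₗ[S] N.obj S
  naturality : ∀ {S T : Type u} [CommRing S] [Algebra R S] [CommRing T] [Algebra R T]
    (f : S →ₐ[R] T) (m : M.obj S), app T (M.map f m) = N.map f (app S m)

/-- A morphism is an isomorphism if and only if each of its components is bijective. -/
def Hom.IsIso {M : ModuleFunctor.{u, v} R} {N : ModuleFunctor.{u, w} R} (φ : Hom M N) : Prop :=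
  ∀ (S : Type u) [CommRing S] [Algebra R S], Function.Bijective (φ.app S)

variable (R) in
/-- The functor `𝓡`, with `𝓡(S) = S`. -/
def structureFunctor : ModuleFunctor.{u, u} R where
  obj S _ _ := S
  addCommGroup S _ _ := inferInstanceAs (AddCommGroup S)
  module S _ _ := inferInstanceAs (Module S S)
  map f := (f : _ →+* _).toAddMonoidHom
  map_smul f s m := map_mul f s m
  map_id _ := rfl
  map_comp _ _ _ := rfl

variable (R) in
/-- The quasi-coherent module associated with an `R`-module `V`, with value `S ⊗ V` at `S`. -/
noncomputable def quasiCoherent (V : Type v) [AddCommGroup V] [Module R V] :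
    ModuleFunctor.{u, max u v} R where
  obj S _ _ := S ⊗[R] V
  addCommGroup S _ _ := inferInstanceAs (AddCommGroup (S ⊗[R] V))
  module S _ _ := inferInstanceAs (Module S (S ⊗[R] V))
  map f := (f.toLinearMap.rTensor V).toAddMonoidHom
  map_smul f s m := by
    induction m using TensorProduct.induction_on with
    | zero => simp
    | tmul a b => simp [TensorProduct.smul_tmul']
    | add x y hx hy => simp only [smul_add, map_add, hx, hy]
  map_id m := by simp
  map_comp g f m := by simp [LinearMap.rTensor_comp_apply]

/-- `M` is (isomorphic to) a quasi-coherent module. -/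
def IsQuasiCoherent (M : ModuleFunctor.{u, u} R) : Prop :=
  ∃ (V : Type u) (_ : AddCommGroup V) (_ : Module R V) (φ : Hom M (quasiCoherent R V)), φ.IsIso

/-! ### Internal Hom, dual, reflexivity -/

/-- The elements of `ℍom(M, N)(S) = Hom_S(M|S, N|S)`: morphisms between the restrictions of `M`
and `N` to commutative `S`-algebras. A commutative `S`-algebra is given as a commutative
`R`-algebra `T` with a structure morphism `f : S →ₐ[R] T`; a morphism of `S`-algebras from
`(T, f)` to `(T', f')` is a morphism of `R`-algebras `g` with `g.comp f = f'`. -/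
@[ext]
structure RestrictedHom (M : ModuleFunctor.{u, v} R) (N : ModuleFunctor.{u, w} R)
    (S : Type u) [CommRing S] [Algebra R S] where
  app : ∀ (T : Type u) [CommRing T] [Algebra R T] (_ : S →ₐ[R] T), M.obj T →ₗ[T] N.obj T
  naturality : ∀ {T T' : Type u} [CommRing T] [Algebra R T] [CommRing T'] [Algebra R T']
    (f : S →ₐ[R] T) (g : T →ₐ[R] T') (m : M.obj T),
    app T' (g.comp f) (M.map g m) = N.map g (app T f m)

namespace RestrictedHom

variable {M : ModuleFunctor.{u, v} R} {N : ModuleFunctor.{u, w} R}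
variable {S : Type u} [CommRing S] [Algebra R S]

instance : Zero (RestrictedHom M N S) :=
  ⟨{ app := fun T _ _ _ => 0
     naturality := fun f g m => by simp }⟩

instance : Add (RestrictedHom M N S) :=
  ⟨fun a b =>
    { app := fun T _ _ f => a.app T f + b.app T f
      naturality := fun f g m => by simp [a.naturality, b.naturality] }⟩

instance : Neg (RestrictedHom M N S) :=
  ⟨fun a =>
    { app := fun T _ _ f => -a.app T f
      naturality := fun f g m => by simp [a.naturality] }⟩

instance : SMul S (RestrictedHom M N S) :=
  ⟨fun s a =>
    { app := fun T _ _ f => f s • a.app T f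
      naturality := fun f g m => by simp [a.naturality, N.map_smul] }⟩

@[simp]
theorem zero_app (T : Type u) [CommRing T] [Algebra R T] (f : S →ₐ[R] T) :
    (0 : RestrictedHom M N S).app T f = 0 := rfl

@[simp]
theorem add_app (a b : RestrictedHom M N S) (T : Type u) [CommRing T] [Algebra R T]
    (f : S →ₐ[R] T) : (a + b).app T f = a.app T f + b.app T f := rfl

@[simp]
theorem neg_app (a : RestrictedHom M N S) (T : Type u) [CommRing T] [Algebra R T]
    (f : S →ₐ[R] T) : (-a).app T f = -a.app T f := rfl

@[simp]
theorem smul_app (s : S) (a : RestrictedHom M N S) (T : Type u) [CommRing T] [Algebra R T]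
    (f : S →ₐ[R] T) : (s • a).app T f = f s • a.app T f := rfl

instance : AddCommGroup (RestrictedHom M N S) where
  add_assoc a b c := by ext; simp [add_assoc]
  zero_add a := by ext; simp
  add_zero a := by ext; simp
  add_comm a b := by ext; simp [add_comm]
  neg_add_cancel a := by ext; simp
  nsmul := nsmulRec
  zsmul := zsmulRec

instance : Module S (RestrictedHom M N S) where
  one_smul a := by ext; simp
  mul_smul s t a := by ext; simp [mul_smul]
  smul_zero s := by ext; simp
  smul_add s a b := by ext; simp
  add_smul s t a := by ext; simp [add_smul]
  zero_smul a := by ext; simp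

end RestrictedHom

/-- The functor of `𝓡`-modules `ℍom(M, N)`. -/
def internalHom (M : ModuleFunctor.{u, v} R) (N : ModuleFunctor.{u, w} R) :
    ModuleFunctor.{u, max (u + 1) v w} R where
  obj S _ _ := RestrictedHom M N S
  map h :=
    { toFun := fun a =>
        { app := fun T _ _ f => a.app T (f.comp h)
          naturality := fun f g m => a.naturality (f.comp h) g m }
      map_zero' := rfl
      map_add' := fun _ _ => rfl }
  map_smul _ _ _ := rfl
  map_id _ := rfl
  map_comp _ _ _ := rfl

/-- The dual `M* = ℍom(M, 𝓡)`. -/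
def dual (M : ModuleFunctor.{u, v} R) : ModuleFunctor.{u, max (u + 1) v} R :=
  internalHom M (structureFunctor R)

/-- The bilinear pairing `M*(S) × M(S) → S`, where `w(m)` is the value at `m` of the component of
`w` at the `S`-algebra `S`. -/
def pairing (M : ModuleFunctor.{u, v} R) (S : Type u) [CommRing S] [Algebra R S] :
    M.dual.obj S →ₗ[S] M.obj S →ₗ[S] S where
  toFun w := RestrictedHom.app (N := structureFunctor R) w S (AlgHom.id R S)
  map_add' _ _ := rfl
  map_smul' _ _ := rfl

theorem pairing_map (M : ModuleFunctor.{u, v} R) {S T : Type u} [CommRing S] [Algebra R S]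
    [CommRing T] [Algebra R T] (f : S →ₐ[R] T) (w : M.dual.obj S) (m : M.obj S) :
    M.pairing T (M.dual.map f w) (M.map f m) = f (M.pairing S w m) :=
  RestrictedHom.naturality (N := structureFunctor R) w (AlgHom.id R S) f m

/-- The natural morphism `M → M**`, sending `m` to the evaluation `w ↦ w(m)`. -/
def toDoubleDual (M : ModuleFunctor.{u, v} R) : Hom M M.dual.dual where
  app S _ _ :=
    { toFun := fun m =>
        { app := fun T _ _ f => (M.pairing T).flip (M.map f m)
          naturality := fun f g w => by
            rw [M.map_comp]
            exact M.pairing_map g w (M.map f m) }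
      map_add' := fun m m' => by
        apply RestrictedHom.ext
        funext T _ _ f
        exact (congrArg (M.pairing T).flip (map_add (M.map f) m m')).trans
          (map_add (M.pairing T).flip _ _)
      map_smul' := fun s m => by
        apply RestrictedHom.ext
        funext T _ _ f
        exact (congrArg (M.pairing T).flip (M.map_smul f s m)).trans
          (LinearMap.map_smul (M.pairing T).flip _ _) }
  naturality f m := by
    apply RestrictedHom.ext
    funext T _ _ g
    exact congrArg (M.pairing T).flip (M.map_comp g f m).symm

/-- `M` is reflexive: the natural morphism `M → M**` is an isomorphism. -/
def IsReflexive (M : ModuleFunctor.{u, v} R) : Prop :=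
  M.toDoubleDual.IsIso

/-! ### Inverse limits -/

/-- An inverse system of functors of `𝓡`-modules, indexed by a preordered set. -/
structure InverseSystem (R : Type u) [CommRing R] (I : Type w) [Preorder I] where
  obj : I → ModuleFunctor.{u, v} R
  trans : ∀ {i j : I}, i ≤ j → Hom (obj j) (obj i)
  trans_refl : ∀ (i : I) (S : Type u) [CommRing S] [Algebra R S] (x : (obj i).obj S),
    (trans (le_refl i)).app S x = x
  trans_trans : ∀ {i j k : I} (hij : i ≤ j) (hjk : j ≤ k) (S : Type u) [CommRing S] [Algebra R S]
    (x : (obj k).obj S),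
    (trans hij).app S ((trans hjk).app S x) = (trans (hij.trans hjk)).app S x

/-- The inverse limit of an inverse system; its value at `S` is the `S`-module of compatible
families. -/
def InverseSystem.limit {I : Type w} [Preorder I] (F : InverseSystem.{u, v, w} R I) :
    ModuleFunctor.{u, max v w} R where
  obj S _ _ :=
    ({ carrier := {x | ∀ (i j : I) (h : i ≤ j), (F.trans h).app S (x j) = x i}
       add_mem' := fun {x y} hx hy i j h => by simp [hx i j h, hy i j h]
       zero_mem' := fun i j h => by simp
       smul_mem' := fun s x hx i j h => by simp [hx i j h] } :
      Submodule S (∀ i : I, (F.obj i).obj S))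
  map f :=
    { toFun := fun x => ⟨fun i => (F.obj i).map f (x.1 i), fun i j h => by
        rw [(F.trans h).naturality, x.2 i j h]⟩
      map_zero' := Subtype.ext (funext fun i => map_zero _)
      map_add' := fun x y => Subtype.ext (funext fun i => map_add _ _ _) }
  map_smul f s x := Subtype.ext (funext fun i => (F.obj i).map_smul f s (x.1 i))
  map_id x := Subtype.ext (funext fun i => (F.obj i).map_id (x.1 i))
  map_comp g f x := Subtype.ext (funext fun i => (F.obj i).map_comp g f (x.1 i))

/-- `M` is proquasi-coherent: it is isomorphic to the inverse limit of an inverse system of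
quasi-coherent modules, indexed by a (nonempty) directed set. -/
def IsProquasiCoherent (M : ModuleFunctor.{u, u} R) : Prop :=
  ∃ (I : Type u) (_ : Preorder I) (_ : Nonempty I) (_ : IsDirected I (· ≤ ·))
    (F : InverseSystem.{u, u, u} R I) (φ : Hom M F.limit),
    (∀ i, (F.obj i).IsQuasiCoherent) ∧ φ.IsIso

/-! ### Quasi-coherent quotients -/

/-- A functor of `𝓡`-submodules of `M`. -/
@[ext]
structure Sub (M : ModuleFunctor.{u, v} R) where
  carrier : ∀ (S : Type u) [CommRing S] [Algebra R S], Submodule S (M.obj S)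
  map_mem : ∀ {S T : Type u} [CommRing S] [Algebra R S] [CommRing T] [Algebra R T]
    (f : S →ₐ[R] T) (m : M.obj S), m ∈ carrier S → M.map f m ∈ carrier T

/-- The quotient `M/N`, with value `M(S)/N(S)` at `S`. -/
def quotient (M : ModuleFunctor.{u, v} R) (N : M.Sub) : ModuleFunctor.{u, v} R where
  obj S _ _ := M.obj S ⧸ N.carrier S
  map {S T} _ _ _ _ f := QuotientAddGroup.map (N.carrier S).toAddSubgroup
    (N.carrier T).toAddSubgroup (M.map f) (fun m hm => N.map_mem f m hm)
  map_smul f s m := by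
    induction m using Submodule.Quotient.induction_on with
    | H m => exact congrArg _ (M.map_smul f s m)
  map_id m := by
    induction m using Submodule.Quotient.induction_on with
    | H m => exact congrArg _ (M.map_id m)
  map_comp g f m := by
    induction m using Submodule.Quotient.induction_on with
    | H m => exact congrArg _ (M.map_comp g f m)

/-- A quasi-coherent quotient of `M`, given by the kernel of the projection. -/
structure QuasiCoherentQuotient (M : ModuleFunctor.{u, u} R) where
  ker : M.Sub
  isQuasiCoherent : (M.quotient ker).IsQuasiCoherent

/-- Quotients are ordered by domination: `i ≤ j` if `M → M_i` factors through `M → M_j`,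
that is, if the kernel of `j` is contained in that of `i`. -/
instance (M : ModuleFunctor.{u, u} R) : Preorder M.QuasiCoherentQuotient where
  le i j := ∀ (S : Type u) [CommRing S] [Algebra R S], j.ker.carrier S ≤ i.ker.carrier S
  le_refl i S _ _ := le_refl _
  le_trans i j k hij hjk S _ _ := (hjk S).trans (hij S)

/-- The inverse system of all quasi-coherent quotients of `M`, with the natural projections. -/
def quotientSystem (M : ModuleFunctor.{u, u} R) :
    InverseSystem.{u, u, u + 1} R M.QuasiCoherentQuotient where
  obj i := M.quotient i.ker
  trans h :=
    { app := fun S _ _ => Submodule.factor (h S)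
      naturality := fun {S T} _ _ _ _ f m => by
        induction m using Submodule.Quotient.induction_on with
        | H m => rfl }
  trans_refl i S _ _ x := by
    induction x using Submodule.Quotient.induction_on with
    | H m => rfl
  trans_trans hij hjk S _ _ x := by
    induction x using Submodule.Quotient.induction_on with
    | H m => rfl

/-- The natural morphism from `M` to the inverse limit of its quasi-coherent quotients. -/
def toQuotientLimit (M : ModuleFunctor.{u, u} R) : Hom M M.quotientSystem.limit where
  app S _ _ :=
    { toFun := fun m => ⟨fun i => (i.ker.carrier S).mkQ m, fun _ _ _ => rfl⟩
      map_add' := fun _ _ => rfl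
      map_smul' := fun _ _ => rfl }
  naturality _ _ := rfl

/-- `M` is the inverse limit of its quasi-coherent quotients. -/
def IsLimitOfQuasiCoherentQuotients (M : ModuleFunctor.{u, u} R) : Prop :=
  M.toQuotientLimit.IsIso

end ModuleFunctor

/-!
Write `𝓥` for the quasi-coherent module of a `K`-vector space `V`.

Quasi-coherent modules are reflexive (`IsQuasiCoherent.isReflexive`). A form on `𝓥*` is given by
its value at the generic point of `𝓥*`, a polynomial in the coordinates with respect to a basis
of `V`; since it involves finitely many variables, an additive form is evaluation at a tensor.
Hence the projections `M** → (M/N)** ≅ M/N` for the quasi-coherent quotients `M/N` define a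
morphism `r : M** → lim M/N` whose composition with `M → M**` is the natural morphism
`M → lim M/N` (`doubleDualToLimit_toDoubleDual`). The theorem follows once `r` is known to be
bijective, which is the case when `M` is the image of a dual functor `N*`. If `M` is reflexive, it
is such an image by the inverse of `M → M**`; if `M = lim M/N`, it is such an image by `r`.

The point about dual functors is that an element of `N*(S)` is the same as a morphism `N → 𝓢`, where
`𝓢` is the quasi-coherent module of the vector space `S` (`inflate`, `pullForm_inflate`). So `N*` is
functorial for all `K`-linear maps `T → T'`, not only for algebra homomorphisms, and every morphism
`N* → 𝓥` respects this (`toTensor_pullForm_comp`): inside the dual numbers `T[ε]`, a linear map out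
of `T` becomes an algebra homomorphism on the square-zero extension `K ⊕ εT`. Applying the linear
forms `T → K`, one sees that a morphism `N* → 𝓥` is determined by its values over `K`
(`toTensor_eq_zero`) and that its image is the quasi-coherent module of the subspace of values over
`K`; the same holds for the images `M` of `N*` (`isQuasiCoherent_quotient_ker`). Consequently
every form on `M` factors through a quasi-coherent quotient, and two quasi-coherent quotients are
dominated by a third, the image of `M` in their product. The first fact makes `r` injective, and
both together make it surjective.

Finally, a quasi-coherent quotient of such an `M` is determined by its kernel over `K`, a subspace
of `M(K)`, so that the limit may be taken over a small directed set.
-/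

namespace ModuleFunctor

universe v' w'

variable {R : Type u} [CommRing R]

/-! ### Morphisms of functors of modules -/

namespace Hom

variable {M : ModuleFunctor.{u, v} R} {N : ModuleFunctor.{u, w} R} {P : ModuleFunctor.{u, v'} R}

/-- The identity morphism. -/
protected def id (M : ModuleFunctor.{u, v} R) : Hom M M where
  app _ _ _ := LinearMap.id
  naturality _ _ := rfl

/-- Composition of morphisms. -/
def comp (g : Hom N P) (f : Hom M N) : Hom M P where
  app S _ _ := g.app S ∘ₗ f.app S
  naturality h m := by simp [f.naturality, g.naturality]

@[simp]
theorem comp_app (g : Hom N P) (f : Hom M N) (S : Type u) [CommRing S] [Algebra R S]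
    (m : M.obj S) : (g.comp f).app S m = g.app S (f.app S m) := rfl

instance : Add (Hom M N) :=
  ⟨fun f g =>
    { app := fun S _ _ => f.app S + g.app S
      naturality := fun h m => by simp [f.naturality, g.naturality] }⟩

@[simp]
theorem add_app (f g : Hom M N) (S : Type u) [CommRing S] [Algebra R S] (m : M.obj S) :
    (f + g).app S m = f.app S m + g.app S m := rfl

/-- The kernel of a morphism, as a functor of submodules. -/
def ker (f : Hom M N) : M.Sub where
  carrier S _ _ := LinearMap.ker (f.app S)
  map_mem h m hm := by
    rw [LinearMap.mem_ker] at hm ⊢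
    rw [f.naturality, hm, map_zero]

/-- A morphism `f : M → N` whose image lies in that of an injective morphism `g : P → N` factors
through `g`. -/
noncomputable def factorThrough (f : Hom M N) (g : Hom P N)
    (hg : ∀ (S : Type u) [CommRing S] [Algebra R S], Function.Injective (g.app S))
    (h : ∀ (S : Type u) [CommRing S] [Algebra R S] (m : M.obj S), ∃ p, g.app S p = f.app S m) :
    Hom M P where
  app S _ _ :=
    { toFun := fun m => (h S m).choose
      map_add' := fun m m' => hg S ((h S (m + m')).choose_spec.trans (by
        rw [map_add, map_add, (h S m).choose_spec, (h S m').choose_spec]))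
      map_smul' := fun s m => hg S ((h S (s • m)).choose_spec.trans (by
        rw [RingHom.id_apply, LinearMap.map_smul, LinearMap.map_smul, (h S m).choose_spec])) }
  naturality {S T} _ _ _ _ φ m := hg T (by
    simp only [LinearMap.coe_mk, AddHom.coe_mk]
    rw [g.naturality, (h S _).choose_spec, (h T _).choose_spec, f.naturality])

theorem factorThrough_spec (f : Hom M N) (g : Hom P N)
    (hg : ∀ (S : Type u) [CommRing S] [Algebra R S], Function.Injective (g.app S))
    (h : ∀ (S : Type u) [CommRing S] [Algebra R S] (m : M.obj S), ∃ p, g.app S p = f.app S m)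
    (S : Type u) [CommRing S] [Algebra R S] (m : M.obj S) :
    g.app S ((factorThrough f g hg h).app S m) = f.app S m :=
  (h S m).choose_spec

/-- The inverse of an isomorphism. -/
noncomputable def inv (f : Hom M N) (hf : f.IsIso) : Hom N M :=
  factorThrough (Hom.id N) f (fun S _ _ => (hf S).1) (fun S _ _ m => (hf S).2 m)

@[simp]
theorem app_inv_app (f : Hom M N) (hf : f.IsIso) (S : Type u) [CommRing S] [Algebra R S]
    (n : N.obj S) : f.app S ((f.inv hf).app S n) = n :=
  factorThrough_spec ..

@[simp]
theorem inv_app_app (f : Hom M N) (hf : f.IsIso) (S : Type u) [CommRing S] [Algebra R S]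
    (m : M.obj S) : (f.inv hf).app S (f.app S m) = m :=
  (hf S).1 (by simp)

end Hom

/-- The projection of `M` onto the quotient `M/N`. -/
def quotientMap (M : ModuleFunctor.{u, v} R) (N : M.Sub) : Hom M (M.quotient N) where
  app S _ _ := (N.carrier S).mkQ
  naturality _ _ := rfl

theorem quotientMap_surjective (M : ModuleFunctor.{u, v} R) (N : M.Sub) (S : Type u) [CommRing S]
    [Algebra R S] : Function.Surjective ((M.quotientMap N).app S) :=
  Submodule.mkQ_surjective _

theorem quotientMap_eq_zero (M : ModuleFunctor.{u, v} R) (N : M.Sub) {S : Type u} [CommRing S]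
    [Algebra R S] {m : M.obj S} : (M.quotientMap N).app S m = 0 ↔ m ∈ N.carrier S :=
  Submodule.Quotient.mk_eq_zero _

/-- The injective morphism `M/ker f → N` induced by `f : M → N`. -/
def Hom.kerLift {M : ModuleFunctor.{u, v} R} {N : ModuleFunctor.{u, w} R} (f : Hom M N) :
    Hom (M.quotient f.ker) N where
  app S _ _ := (f.ker.carrier S).liftQ (f.app S) le_rfl
  naturality {S T} _ _ _ _ h m := by
    induction m using Submodule.Quotient.induction_on with
    | H m => exact f.naturality h m

theorem Hom.kerLift_quotientMap {M : ModuleFunctor.{u, v} R} {N : ModuleFunctor.{u, w} R}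
    (f : Hom M N) (S : Type u) [CommRing S] [Algebra R S] (m : M.obj S) :
    f.kerLift.app S ((M.quotientMap f.ker).app S m) = f.app S m := rfl

theorem Hom.kerLift_injective {M : ModuleFunctor.{u, v} R} {N : ModuleFunctor.{u, w} R}
    (f : Hom M N) (S : Type u) [CommRing S] [Algebra R S] :
    Function.Injective (f.kerLift.app S) :=
  LinearMap.ker_eq_bot.mp (Submodule.ker_liftQ_eq_bot _ _ _ le_rfl)

/-! ### The dual functor -/

section Dual

variable {M : ModuleFunctor.{u, v} R} {N : ModuleFunctor.{u, w} R} {P : ModuleFunctor.{u, v'} R}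
variable {S : Type u} [CommRing S] [Algebra R S]

/-- The component of `w ∈ M*(S)` at an `S`-algebra `f : S →ₐ[R] T`, as a `T`-linear form. -/
def dualEval (w : M.dual.obj S) (T : Type u) [CommRing T] [Algebra R T] (f : S →ₐ[R] T) :
    M.obj T →ₗ[T] T :=
  RestrictedHom.app (N := structureFunctor R) w T f

/-- An element of `M*(S)` from its components. -/
def dualMk (app : ∀ (T : Type u) [CommRing T] [Algebra R T] (_ : S →ₐ[R] T), M.obj T →ₗ[T] T)
    (naturality : ∀ {T T' : Type u} [CommRing T] [Algebra R T] [CommRing T'] [Algebra R T']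
      (f : S →ₐ[R] T) (g : T →ₐ[R] T') (m : M.obj T),
      app T' (g.comp f) (M.map g m) = g (app T f m)) : M.dual.obj S :=
  RestrictedHom.mk (N := structureFunctor R) app naturality

theorem dual_ext {w w' : M.dual.obj S}
    (h : ∀ (T : Type u) [CommRing T] [Algebra R T] (f : S →ₐ[R] T) (m : M.obj T),
      dualEval w T f m = dualEval w' T f m) : w = w' :=
  RestrictedHom.ext (by funext T _ _ f; exact LinearMap.ext (h T f))

theorem dualEval_naturality (w : M.dual.obj S) {T T' : Type u} [CommRing T] [Algebra R T]
    [CommRing T'] [Algebra R T'] (f : S →ₐ[R] T) (g : T →ₐ[R] T') (m : M.obj T) :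
    dualEval w T' (g.comp f) (M.map g m) = g (dualEval w T f m) :=
  RestrictedHom.naturality (N := structureFunctor R) w f g m

@[simp]
theorem dualEval_add (w w' : M.dual.obj S) (T : Type u) [CommRing T] [Algebra R T]
    (f : S →ₐ[R] T) : dualEval (w + w') T f = dualEval w T f + dualEval w' T f := rfl

@[simp]
theorem dualEval_smul (s : S) (w : M.dual.obj S) (T : Type u) [CommRing T] [Algebra R T]
    (f : S →ₐ[R] T) : dualEval (s • w) T f = f s • dualEval w T f := rfl

theorem dualEval_toDoubleDual (m : M.obj S) (T : Type u) [CommRing T] [Algebra R T]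
    (f : S →ₐ[R] T) (w : M.dual.obj T) :
    dualEval (M.toDoubleDual.app S m) T f w = dualEval w T (AlgHom.id R T) (M.map f m) := rfl

/-- The transpose `N* → M*` of a morphism `M → N`. -/
def dualMap (φ : Hom M N) : Hom N.dual M.dual where
  app S _ _ :=
    { toFun := fun w => dualMk (fun T _ _ f => dualEval w T f ∘ₗ φ.app T) (fun f g m => by
        simp [φ.naturality, dualEval_naturality])
      map_add' := fun _ _ => rfl
      map_smul' := fun _ _ => rfl }
  naturality _ _ := rfl

@[simp]
theorem dualEval_dualMap (φ : Hom M N) (w : N.dual.obj S) (T : Type u) [CommRing T] [Algebra R T]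
    (f : S →ₐ[R] T) (m : M.obj T) :
    dualEval ((dualMap φ).app S w) T f m = dualEval w T f (φ.app T m) := rfl

theorem dualMap_injective (φ : Hom M N)
    (hφ : ∀ (T : Type u) [CommRing T] [Algebra R T], Function.Surjective (φ.app T)) :
    Function.Injective ((dualMap φ).app S) := by
  intro w w' h
  refine dual_ext fun T _ _ f n => ?_
  obtain ⟨m, rfl⟩ := hφ T n
  rw [← dualEval_dualMap, h, dualEval_dualMap]

theorem toDoubleDual_naturality (φ : Hom M N) (m : M.obj S) :
    N.toDoubleDual.app S (φ.app S m) =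
      (dualMap (dualMap φ)).app S (M.toDoubleDual.app S m) := by
  refine dual_ext fun T _ _ f w => ?_
  simp [dualEval_toDoubleDual, φ.naturality]

end Dual

/-! ### Quasi-coherent modules -/

section QuasiCoherent

variable {M : ModuleFunctor.{u, v} R}
variable {V : Type w} [AddCommGroup V] [Module R V] {W : Type w'} [AddCommGroup W] [Module R W]

/-- The component at `S` of a morphism to a quasi-coherent module, with values in `S ⊗ V`. -/
def Hom.toTensor (f : Hom M (quasiCoherent R V)) (S : Type u) [CommRing S] [Algebra R S] :
    M.obj S →ₗ[S] S ⊗[R] V :=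
  f.app S

theorem Hom.toTensor_map (f : Hom M (quasiCoherent R V)) {S T : Type u} [CommRing S]
    [Algebra R S] [CommRing T] [Algebra R T] (h : S →ₐ[R] T) (m : M.obj S) :
    f.toTensor T (M.map h m) = h.toLinearMap.rTensor V (f.toTensor S m) :=
  f.naturality h m

/-- The morphism of quasi-coherent modules induced by a linear map. -/
noncomputable def quasiCoherentMap (h : V →ₗ[R] W) :
    Hom (quasiCoherent R V) (quasiCoherent R W) where
  app S _ _ := (h.baseChange S : S ⊗[R] V →ₗ[S] S ⊗[R] W)
  naturality {S T} _ _ _ _ f m := by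
    change (h.baseChange T) (f.toLinearMap.rTensor V m) =
      f.toLinearMap.rTensor W ((h.baseChange S) m)
    induction m using TensorProduct.induction_on with
    | zero => simp
    | tmul a b => simp
    | add x y hx hy => simp only [map_add, hx, hy]

theorem toTensor_quasiCoherentMap_comp (h : V →ₗ[R] W) (f : Hom M (quasiCoherent R V))
    (S : Type u) [CommRing S] [Algebra R S] (m : M.obj S) :
    ((quasiCoherentMap h).comp f).toTensor S m = h.baseChange S (f.toTensor S m) := rfl

theorem map_liftBaseChange {T T' : Type u} [CommRing T] [Algebra R T] [CommRing T']
    [Algebra R T'] (g : T →ₐ[R] T') (h : V →ₗ[R] T) (x : T ⊗[R] V) :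
    (g.toLinearMap ∘ₗ h).liftBaseChange T' (g.toLinearMap.rTensor V x) =
      g (h.liftBaseChange T x) := by
  induction x using TensorProduct.induction_on with
  | zero => simp
  | tmul a b => simp
  | add x y hx hy => simp only [map_add, hx, hy]

/-- For `φ : M → 𝓥`, the element of `M*(S)` obtained by composing `φ` with the linear form on
`𝓥|S` defined by a linear map `h : V → S`. -/
noncomputable def pullForm {S : Type u} [CommRing S] [Algebra R S] (φ : Hom M (quasiCoherent R V))
    (h : V →ₗ[R] S) : M.dual.obj S :=
  dualMk (fun T _ _ f => (f.toLinearMap ∘ₗ h).liftBaseChange T ∘ₗ φ.toTensor T) (fun f g m => by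
    simp only [LinearMap.comp_apply, φ.toTensor_map, ← map_liftBaseChange]
    rfl)

theorem dualEval_pullForm {S : Type u} [CommRing S] [Algebra R S] (φ : Hom M (quasiCoherent R V))
    (h : V →ₗ[R] S) (T : Type u) [CommRing T] [Algebra R T] (f : S →ₐ[R] T) (m : M.obj T) :
    dualEval (pullForm φ h) T f m =
      (f.toLinearMap ∘ₗ h).liftBaseChange T (φ.toTensor T m) := rfl

theorem map_pullForm {S : Type u} [CommRing S] [Algebra R S] (φ : Hom M (quasiCoherent R V))
    (h : V →ₗ[R] S) (T : Type u) [CommRing T] [Algebra R T] (f : S →ₐ[R] T) :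
    M.dual.map f (pullForm φ h) = pullForm φ (f.toLinearMap ∘ₗ h) := rfl

theorem pullForm_add {S : Type u} [CommRing S] [Algebra R S] (φ : Hom M (quasiCoherent R V))
    (h h' : V →ₗ[R] S) : pullForm φ (h + h') = pullForm φ h + pullForm φ h' := by
  refine dual_ext fun T _ _ f m => ?_
  simp [dualEval_pullForm, LinearMap.comp_add]

theorem pullForm_smul {S : Type u} [CommRing S] [Algebra R S] (φ : Hom M (quasiCoherent R V))
    (s : S) (h : V →ₗ[R] S) : pullForm φ (s • h) = s • pullForm φ h := by
  refine dual_ext fun T _ _ f m => ?_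
  have : f.toLinearMap ∘ₗ (s • h) = f s • (f.toLinearMap ∘ₗ h) := by
    ext; simp
  simp [dualEval_pullForm, this]

end QuasiCoherent

/-! ### Quasi-coherent modules are reflexive -/

section QuasiCoherentReflexive

variable {K : Type u} [Field K] {M : ModuleFunctor.{u, v} K}
variable {V : Type u} [AddCommGroup V] [Module K V]

theorem eq_zero_of_liftBaseChange_coord {ι : Type*} (b : Module.Basis ι K V) {S : Type*}
    [CommRing S] [Algebra K S] (x : S ⊗[K] V)
    (h : ∀ i, (Algebra.linearMap K S ∘ₗ b.coord i).liftBaseChange S x = 0) : x = 0 := by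
  refine (b.baseChange S).ext_elem fun i => ?_
  have key : ∀ y : S ⊗[K] V, (b.baseChange S).repr y i =
      (Algebra.linearMap K S ∘ₗ b.coord i).liftBaseChange S y := by
    intro y
    induction y using TensorProduct.induction_on with
    | zero => simp
    | tmul s v => simp [Algebra.smul_def, mul_comm]
    | add x y hx hy => simp only [map_add, Finsupp.add_apply, hx, hy]
  rw [key, h, map_zero, Finsupp.zero_apply]

theorem toDoubleDual_injective_of_isIso (φ : Hom M (quasiCoherent K V)) (hφ : φ.IsIso)
    (S : Type u) [CommRing S] [Algebra K S] : Function.Injective (M.toDoubleDual.app S) := by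
  rw [injective_iff_map_eq_zero]
  intro m hm
  refine (injective_iff_map_eq_zero (φ.toTensor S)).mp (hφ S).1 m ?_
  let b := Module.Basis.ofVectorSpace K V
  refine eq_zero_of_liftBaseChange_coord b _ fun i => ?_
  have := dualEval_toDoubleDual m S (AlgHom.id K S)
    (pullForm φ (Algebra.linearMap K S ∘ₗ b.coord i))
  rw [hm, M.map_id, dualEval_pullForm] at this
  exact this.symm

/-- Every form on `M ≅ 𝓥` is given by a linear map on `V`. -/
theorem exists_eq_pullForm (φ : Hom M (quasiCoherent K V)) (hφ : φ.IsIso)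
    {S : Type u} [CommRing S] [Algebra K S] (w : M.dual.obj S) :
    ∃ h : V →ₗ[K] S, w = pullForm φ h := by
  let ψ : ∀ (T : Type u) [CommRing T] [Algebra K T], T ⊗[K] V →ₗ[T] M.obj T :=
    fun T _ _ => (φ.inv hφ).app T
  have hψ : ∀ (T : Type u) [CommRing T] [Algebra K T] (m : M.obj T),
    ψ T (φ.toTensor T m) = m := fun T _ _ m => φ.inv_app_app hφ T m
  have hψn : ∀ (T T' : Type u) [CommRing T] [Algebra K T] [CommRing T'] [Algebra K T']
      (f : T →ₐ[K] T') (x : T ⊗[K] V), ψ T' (f.toLinearMap.rTensor V x) = M.map f (ψ T x) :=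
    fun T T' _ _ _ _ f x => (φ.inv hφ).naturality f x
  let h : V →ₗ[K] S := (dualEval w S (AlgHom.id K S) ∘ₗ ψ S).restrictScalars K ∘ₗ
    TensorProduct.mk K S V 1
  refine ⟨h, dual_ext fun T _ _ f m => ?_⟩
  rw [dualEval_pullForm]
  rw [← hψ T m]
  generalize φ.toTensor T m = x
  have : dualEval w T f ∘ₗ ψ T = (f.toLinearMap ∘ₗ h).liftBaseChange T := by
    refine TensorProduct.AlgebraTensorModule.curry_injective ?_
    ext v
    have h1 := hψn S T f ((1 : S) ⊗ₜ[K] v)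
    have h2 := dualEval_naturality w (AlgHom.id K S) f (ψ S (1 ⊗ₜ[K] v))
    simp only [LinearMap.rTensor_tmul, AlgHom.toLinearMap_apply, map_one] at h1
    simpa [h1, h] using h2
  have h3 : φ.toTensor T (ψ T x) = x := φ.app_inv_app hφ T x
  rw [h3]
  exact LinearMap.congr_fun this x

/-- A form on `𝓥*` is the evaluation of a single polynomial in the coordinates of `V → T`, namely
of its value at the generic point. The polynomial involves only finitely many variables, so the
form only sees finitely many coordinates and is evaluation at an element of `S ⊗ V`. -/
theorem toDoubleDual_surjective_of_isIso (φ : Hom M (quasiCoherent K V)) (hφ : φ.IsIso)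
    (S : Type u) [CommRing S] [Algebra K S] : Function.Surjective (M.toDoubleDual.app S) := by
  intro β
  let b := Module.Basis.ofVectorSpace K V
  let ι := Module.Basis.ofVectorSpaceIndex K V
  let form : ∀ (T : Type u) [CommRing T] [Algebra K T], (ι → T) →ₗ[T] M.dual.obj T :=
    fun T _ _ =>
      { toFun := fun t => pullForm φ (b.constr T t)
        map_add' := fun t t' => by rw [map_add, pullForm_add]
        map_smul' := fun s t => by rw [LinearEquiv.map_smul, pullForm_smul]; rfl }
  have form_map : ∀ (T T' : Type u) [CommRing T] [Algebra K T] [CommRing T'] [Algebra K T']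
      (g : T →ₐ[K] T') (t : ι → T), M.dual.map g (form T t) = form T' (fun i => g (t i)) := by
    intro T T' _ _ _ _ g t
    refine (map_pullForm φ _ T' g).trans ?_
    refine congrArg (pullForm φ) (b.ext fun i => ?_)
    simp
  let C : S →ₐ[K] MvPolynomial ι S := IsScalarTower.toAlgHom K S (MvPolynomial ι S)
  let p : MvPolynomial ι S := dualEval β _ C (form _ MvPolynomial.X)
  -- by naturality along the evaluation `S[X] → T` at `t`, the polynomial `p` computes `β`
  have eval_p : ∀ (T : Type u) [CommRing T] [Algebra K T] (f : S →ₐ[K] T) (t : ι → T),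
      dualEval β T f (form T t) = MvPolynomial.eval₂Hom (f : S →+* T) t p := by
    intro T _ _ f t
    let g : MvPolynomial ι S →ₐ[K] T :=
      { MvPolynomial.eval₂Hom (f : S →+* T) t with
        commutes' := fun r => by
          simp [MvPolynomial.algebraMap_eq, IsScalarTower.algebraMap_apply K S (MvPolynomial ι S)] }
    have hg : g.comp C = f := by
      ext s
      change MvPolynomial.eval₂Hom (f : S →+* T) t (MvPolynomial.C s) = f s
      simp
    have := dualEval_naturality β C g (form _ MvPolynomial.X)
    rw [hg, form_map] at this
    refine Eq.trans ?_ this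
    congr 2
    funext i
    exact (MvPolynomial.eval₂Hom_X' (f : S →+* T) t i).symm
  classical
  let x : S ⊗[K] V := ∑ i ∈ p.vars,
    dualEval β S (AlgHom.id K S) (form S (Pi.single i 1)) ⊗ₜ[K] b i
  obtain ⟨m, hm⟩ := (hφ S).2 x
  refine ⟨m, dual_ext fun T _ _ f w => ?_⟩
  obtain ⟨h, rfl⟩ := exists_eq_pullForm φ hφ w
  have hh : pullForm φ h = form T (fun i => h (b i)) :=
    congrArg (pullForm φ) (b.ext fun i => by simp)
  -- only the coordinates with index in `p.vars` matter
  have htrunc : dualEval β T f (form T (fun i => h (b i))) =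
      dualEval β T f (form T (∑ i ∈ p.vars, h (b i) • Pi.single i 1)) := by
    rw [eval_p, eval_p]
    refine MvPolynomial.eval₂Hom_congr' rfl (fun i hi _ => ?_) rfl
    simp [Finset.sum_apply, Pi.single_apply, hi]
  have hsingle : ∀ i : ι, dualEval β T f (form T (Pi.single i 1)) =
      f (dualEval β S (AlgHom.id K S) (form S (Pi.single i 1))) := by
    intro i
    rw [← dualEval_naturality β (AlgHom.id K S) f, form_map]
    congr 2
    funext j
    by_cases hj : j = i
    · subst hj; simp
    · simp [hj]
  have hm' : φ.toTensor T (M.map f m) = f.toLinearMap.rTensor V x := by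
    rw [φ.toTensor_map]; exact congrArg _ hm
  rw [dualEval_toDoubleDual, dualEval_pullForm, hm', hh, htrunc]
  simp [x, hsingle, mul_comm]

theorem IsQuasiCoherent.isReflexive {M : ModuleFunctor.{u, u} K} (hM : M.IsQuasiCoherent) :
    M.IsReflexive := by
  obtain ⟨V, _, _, φ, hφ⟩ := hM
  exact fun S _ _ =>
    ⟨toDoubleDual_injective_of_isIso φ hφ S, toDoubleDual_surjective_of_isIso φ hφ S⟩

end QuasiCoherentReflexive

/-! ### Linear maps acting on dual functors -/

section Inflate

variable {R : Type u} [CommRing R] {N : ModuleFunctor.{u, v} R} {S : Type u} [CommRing S]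
  [Algebra R S]

/-- The morphism `N → 𝓢` to the quasi-coherent module of the `R`-module `S` that corresponds to
`w ∈ N*(S)` by adjunction: `N(T) → N(T ⊗ S) → T ⊗ S`, where the second map is a component
of `w`. -/
noncomputable def inflate (w : N.dual.obj S) : Hom N (quasiCoherent R S) where
  app T _ _ :=
    ({ toFun := fun n => dualEval w (T ⊗[R] S) Algebra.TensorProduct.includeRight
          (N.map Algebra.TensorProduct.includeLeft n)
       map_add' := fun n n' => by simp
       map_smul' := fun t n => by
        rw [N.map_smul, LinearMap.map_smul, RingHom.id_apply, Algebra.smul_def t, smul_eq_mul]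
        rfl } : N.obj T →ₗ[T] T ⊗[R] S)
  naturality {T T'} _ _ _ _ f n := by
    change dualEval w (T' ⊗[R] S) Algebra.TensorProduct.includeRight
        (N.map Algebra.TensorProduct.includeLeft (N.map f n)) =
      Algebra.TensorProduct.map f (AlgHom.id R S) (dualEval w (T ⊗[R] S)
        Algebra.TensorProduct.includeRight (N.map Algebra.TensorProduct.includeLeft n))
    rw [← dualEval_naturality, ← N.map_comp, ← N.map_comp]
    congr 2
    ext; simp

theorem toTensor_inflate (w : N.dual.obj S) (T : Type u) [CommRing T] [Algebra R T]
    (n : N.obj T) :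
    (inflate w).toTensor T n = dualEval w (T ⊗[R] S) Algebra.TensorProduct.includeRight
      (N.map Algebra.TensorProduct.includeLeft n) := rfl

theorem pullForm_inflate (w : N.dual.obj S) : pullForm (inflate w) LinearMap.id = w := by
  refine dual_ext fun T _ _ f n => ?_
  let μ : T ⊗[R] S →ₐ[R] T := Algebra.TensorProduct.productMap (AlgHom.id R T) f
  have hμ : ∀ x, (f.toLinearMap ∘ₗ LinearMap.id).liftBaseChange T x = μ x := by
    intro x
    induction x using TensorProduct.induction_on with
    | zero => simp
    | tmul a b => simp [μ]
    | add x y hx hy => simp only [map_add, hx, hy]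
  rw [dualEval_pullForm, hμ, toTensor_inflate, ← dualEval_naturality, ← N.map_comp]
  have h1 : μ.comp Algebra.TensorProduct.includeRight = f := by ext; simp [μ]
  have h2 : μ.comp Algebra.TensorProduct.includeLeft = AlgHom.id R T := by ext; simp [μ]
  rw [h1, h2, N.map_id]

end Inflate

section Field

variable {K : Type u} [Field K]

theorem eq_zero_of_rTensor_eq_zero {T : Type*} [AddCommGroup T] [Module K T] {V : Type*}
    [AddCommGroup V] [Module K V] (x : T ⊗[K] V)
    (h : ∀ l : T →ₗ[K] K, l.rTensor V x = 0) : x = 0 := by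
  classical
  let b := Module.Basis.ofVectorSpace K T
  refine (TensorProduct.equivFinsuppOfBasisLeft b).injective (Finsupp.ext fun i => ?_)
  rw [TensorProduct.equivFinsuppOfBasisLeft_apply, h]
  simp

variable {N : ModuleFunctor.{u, v} K} {V W : Type u} [AddCommGroup V] [Module K V]
  [AddCommGroup W] [Module K W]

theorem pullForm_zero {S : Type u} [CommRing S] [Algebra K S] (φ : Hom N (quasiCoherent K W)) :
    pullForm φ (0 : W →ₗ[K] S) = 0 := by
  simpa using pullForm_smul φ (0 : S) 0

/-- The key step of `toTensor_pullForm_comp`, for the inclusion of `T` in the square-zero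
extension `K ⊕ T`: over the dual numbers `T[ε]`, which contain `K ⊕ εT`, this inclusion becomes
the product of the scalar `ε` and an algebra homomorphism. -/
theorem toTensor_pullForm_inr (F : Hom N.dual (quasiCoherent K V)) (φ : Hom N (quasiCoherent K W))
    {T : Type u} [CommRing T] [Algebra K T] [Module Kᵐᵒᵖ T] [IsCentralScalar K T]
    (h : W →ₗ[K] T) :
    F.toTensor (TrivSqZeroExt K T) (pullForm φ (TrivSqZeroExt.inrHom K T ∘ₗ h)) =
      (TrivSqZeroExt.inrHom K T).rTensor V (F.toTensor T (pullForm φ h)) := by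
  cases subsingleton_or_nontrivial T with
  | inl _ =>
    -- here `K ⊕ T` is not contained in `T[ε] = 0`, but all maps through `T` vanish
    have h1 : TrivSqZeroExt.inrHom K T = 0 :=
      LinearMap.ext fun t => by rw [Subsingleton.elim t 0, map_zero, map_zero]
    rw [h1, LinearMap.zero_comp, pullForm_zero, map_zero, LinearMap.rTensor_zero,
      LinearMap.zero_apply]
  | inr _ =>
    let can : T →ₐ[K] TrivSqZeroExt T T := TrivSqZeroExt.inlAlgHom K T T
    let ε : TrivSqZeroExt T T := TrivSqZeroExt.inr 1
    let j : TrivSqZeroExt K T →ₐ[K] TrivSqZeroExt T T :=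
      TrivSqZeroExt.lift (Algebra.ofId K _)
        ((TrivSqZeroExt.inrHom T T).restrictScalars K) (fun x y => by simp)
        (fun r x => by rw [LinearMap.map_smul, Algebra.smul_def, Algebra.ofId_apply])
        (fun r x => by
          rw [op_smul_eq_smul, LinearMap.map_smul, Algebra.smul_def, Algebra.ofId_apply, mul_comm])
    have hj : j.toLinearMap ∘ₗ TrivSqZeroExt.inrHom K T = ε • can.toLinearMap := by
      ext t
      · simp [j, can, ε]
      · simp [j, can, ε]
    have hj_inj : Function.Injective j := by
      rw [injective_iff_map_eq_zero]
      intro x hx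
      have hjx : TrivSqZeroExt.inl (algebraMap K T x.fst) + TrivSqZeroExt.inr x.snd =
          (0 : TrivSqZeroExt T T) := 
        (TrivSqZeroExt.lift_def (Algebra.ofId K (TrivSqZeroExt T T))
          ((TrivSqZeroExt.inrHom T T).restrictScalars K) _ _ _ x).symm.trans hx
      have h1 := congrArg TrivSqZeroExt.fst hjx
      have h2 := congrArg TrivSqZeroExt.snd hjx
      rw [TrivSqZeroExt.fst_add, TrivSqZeroExt.fst_inl, TrivSqZeroExt.fst_inr, add_zero] at h1
      rw [TrivSqZeroExt.snd_add, TrivSqZeroExt.snd_inl, TrivSqZeroExt.snd_inr, zero_add] at h2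
      refine TrivSqZeroExt.ext ((algebraMap K T).injective ?_) h2
      rw [h1, TrivSqZeroExt.fst_zero, TrivSqZeroExt.fst_zero, map_zero]
    have hjV : Function.Injective (j.toLinearMap.rTensor V) :=
      Module.Flat.rTensor_preserves_injective_linearMap _ hj_inj
    have hεV : ∀ x : T ⊗[K] V, (ε • can.toLinearMap).rTensor V x =
        ε • can.toLinearMap.rTensor V x := by
      intro x
      induction x using TensorProduct.induction_on with
      | zero => simp
      | tmul a b => simp [TensorProduct.smul_tmul']
      | add x y hx hy => simp only [map_add, smul_add, hx, hy]
    apply hjV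
    rw [← F.toTensor_map, map_pullForm, ← LinearMap.comp_assoc, hj, ← LinearMap.comp_apply,
      ← LinearMap.rTensor_comp, hj, hεV, LinearMap.smul_comp, pullForm_smul, LinearMap.map_smul,
      ← map_pullForm, F.toTensor_map]

/-- Morphisms from a dual functor `N*` to a quasi-coherent module commute with `K`-linear maps
`T → T'`, not only with algebra homomorphisms. -/
theorem toTensor_pullForm_comp (F : Hom N.dual (quasiCoherent K V))
    (φ : Hom N (quasiCoherent K W)) {T T' : Type u} [CommRing T] [Algebra K T] [CommRing T']
    [Algebra K T'] (h : W →ₗ[K] T) (l : T →ₗ[K] T') :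
    F.toTensor T' (pullForm φ (l ∘ₗ h)) = l.rTensor V (F.toTensor T (pullForm φ h)) := by
  let _ : Module Kᵐᵒᵖ T := Module.compHom T ((RingHom.id K).fromOpposite mul_comm)
  let _ : Module Kᵐᵒᵖ T' := Module.compHom T' ((RingHom.id K).fromOpposite mul_comm)
  have _ : IsCentralScalar K T := ⟨fun _ _ => rfl⟩
  have _ : IsCentralScalar K T' := ⟨fun _ _ => rfl⟩
  have hinj : Function.Injective ((TrivSqZeroExt.inrHom K T').rTensor V) :=
    Module.Flat.rTensor_preserves_injective_linearMap _ TrivSqZeroExt.inr_injective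
  let m : TrivSqZeroExt K T →ₐ[K] TrivSqZeroExt K T' := TrivSqZeroExt.map l
  have hm : m.toLinearMap ∘ₗ TrivSqZeroExt.inrHom K T = TrivSqZeroExt.inrHom K T' ∘ₗ l := by
    ext <;> simp [m]
  apply hinj
  rw [← toTensor_pullForm_inr, ← LinearMap.comp_assoc, ← hm, LinearMap.comp_assoc, ← map_pullForm,
    F.toTensor_map, toTensor_pullForm_inr, ← LinearMap.comp_apply, ← LinearMap.rTensor_comp, hm,
    LinearMap.rTensor_comp, LinearMap.comp_apply]

/-- The value at `w ∈ N*(T)` of a morphism from `N*` to a quasi-coherent module is determined by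
its values at the elements of `N*(K)` obtained from `w` by the linear forms on `T`. -/
theorem toTensor_eq_zero (F : Hom N.dual (quasiCoherent K V)) {T : Type u} [CommRing T]
    [Algebra K T] (w : N.dual.obj T)
    (h : ∀ l : T →ₗ[K] K, F.toTensor K (pullForm (inflate w) l) = 0) : F.toTensor T w = 0 := by
  refine eq_zero_of_rTensor_eq_zero _ fun l => ?_
  have := toTensor_pullForm_comp F (inflate w) LinearMap.id l
  rw [pullForm_inflate, LinearMap.comp_id] at this
  rw [← this, h]

end Field

/-! ### Images of dual functors in quasi-coherent modules -/

section Image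

variable {K : Type u} [Field K] {N : ModuleFunctor.{u, v} K} {M : ModuleFunctor.{u, u} K}

/-- If `M` is the image of a dual functor `N*`, then the image of any morphism `f : M → 𝓥` is the
quasi-coherent module of the space of those vectors of `V` that are attained by `f` over `K`. -/
theorem isQuasiCoherent_quotient_ker (p : Hom N.dual M)
    (hp : ∀ (S : Type u) [CommRing S] [Algebra K S], Function.Surjective (p.app S))
    {V : Type u} [AddCommGroup V] [Module K V] (f : Hom M (quasiCoherent K V)) :
    (M.quotient f.ker).IsQuasiCoherent := by
  let F : Hom N.dual (quasiCoherent K V) := f.comp p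
  let V' : Submodule K V :=
    LinearMap.range ((TensorProduct.lid K V).toLinearMap ∘ₗ F.toTensor K)
  let g : Hom (quasiCoherent K V') (quasiCoherent K V) := quasiCoherentMap V'.subtype
  have g_inj : ∀ (T : Type u) [CommRing T] [Algebra K T], Function.Injective (g.app T) :=
    fun T _ _ => Module.Flat.lTensor_preserves_injective_linearMap (M := T) V'.subtype
      V'.injective_subtype
  -- modulo `V'` the morphism `F` vanishes over `K`, hence everywhere
  have hK : ∀ w : N.dual.obj K,
      ((quasiCoherentMap V'.mkQ).comp F).toTensor K w = 0 := by
    intro w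
    rw [toTensor_quasiCoherentMap_comp]
    obtain ⟨v, hv⟩ := (TensorProduct.lid K V).symm.surjective (F.toTensor K w)
    have hv' : v ∈ V' := ⟨w, by simp [← hv]⟩
    rw [← hv, TensorProduct.lid_symm_apply, LinearMap.baseChange_tmul, Submodule.mkQ_apply,
      (Submodule.Quotient.mk_eq_zero V').mpr hv', TensorProduct.tmul_zero]
  have range_le : ∀ (T : Type u) [CommRing T] [Algebra K T] (w : N.dual.obj T),
      ∃ y, g.app T y = F.app T w := by
    intro T _ _ w
    have h0 := toTensor_eq_zero ((quasiCoherentMap V'.mkQ).comp F) w (fun l => hK _)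
    rw [toTensor_quasiCoherentMap_comp] at h0
    have hex : Function.Exact V'.subtype V'.mkQ := LinearMap.exact_subtype_mkQ V'
    exact (lTensor_exact T hex V'.mkQ_surjective _).mp h0
  have le_range : ∀ (T : Type u) [CommRing T] [Algebra K T] (y : T ⊗[K] V'),
      ∃ w, F.app T w = g.app T y := by
    intro T _ _ y
    induction y using TensorProduct.induction_on with
    | zero => exact ⟨0, (map_zero _).trans (map_zero (g.app T)).symm⟩
    | add x y hx hy =>
      obtain ⟨w, hw⟩ := hx
      obtain ⟨w', hw'⟩ := hy
      exact ⟨w + w', by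
        rw [map_add, hw, hw']; exact (map_add (g.app T) x y).symm⟩
    | tmul t v =>
      obtain ⟨d, hd⟩ := v.2
      refine ⟨t • N.dual.map (Algebra.ofId K T) d, ?_⟩
      have hd' : F.toTensor K d = (1 : K) ⊗ₜ[K] (v : V) := by
        rw [← TensorProduct.lid_symm_apply, ← hd]
        simp
      change F.toTensor T _ = V'.subtype.baseChange T (t ⊗ₜ v)
      rw [LinearMap.map_smul, F.toTensor_map, hd']
      simp [TensorProduct.smul_tmul']
  have hker : ∀ (T : Type u) [CommRing T] [Algebra K T] (m : (M.quotient f.ker).obj T),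
      ∃ y, g.app T y = f.kerLift.app T m := by
    intro T _ _ m
    obtain ⟨m, rfl⟩ := M.quotientMap_surjective f.ker T m
    obtain ⟨w, rfl⟩ := hp T m
    exact range_le T w
  refine ⟨V', inferInstance, inferInstance, f.kerLift.factorThrough g g_inj hker,
    fun T _ _ => ⟨fun x y hxy => ?_, fun y => ?_⟩⟩
  · apply f.kerLift_injective T
    rw [← Hom.factorThrough_spec f.kerLift g g_inj hker T x, hxy, Hom.factorThrough_spec]
  · obtain ⟨w, hw⟩ := le_range T y
    refine ⟨(M.quotientMap f.ker).app T (p.app T w), g_inj T ?_⟩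
    rw [Hom.factorThrough_spec, f.kerLift_quotientMap]
    exact hw

/-- The kernel of a quasi-coherent quotient is the kernel of a morphism to some `𝓥`. -/
theorem QuasiCoherentQuotient.exists_toTensor (i : M.QuasiCoherentQuotient) :
    ∃ (V : Type u) (_ : AddCommGroup V) (_ : Module K V) (f : Hom M (quasiCoherent K V)),
      ∀ (S : Type u) [CommRing S] [Algebra K S] (m : M.obj S),
        m ∈ i.ker.carrier S ↔ f.toTensor S m = 0 := by
  obtain ⟨V, _, _, φ, hφ⟩ := i.isQuasiCoherent
  refine ⟨V, _, _, φ.comp (M.quotientMap i.ker), fun S _ _ m => ?_⟩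
  rw [← M.quotientMap_eq_zero]
  exact (map_eq_zero_iff (φ.app S) (hφ S).1).symm

theorem directed_quasiCoherentQuotient (p : Hom N.dual M)
    (hp : ∀ (S : Type u) [CommRing S] [Algebra K S], Function.Surjective (p.app S))
    (i j : M.QuasiCoherentQuotient) : ∃ k, i ≤ k ∧ j ≤ k := by
  obtain ⟨V, _, _, f, hf⟩ := i.exists_toTensor
  obtain ⟨W, _, _, g, hg⟩ := j.exists_toTensor
  let h : Hom M (quasiCoherent K (V × W)) :=
    (quasiCoherentMap (LinearMap.inl K V W)).comp f +
      (quasiCoherentMap (LinearMap.inr K V W)).comp g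
  have hh : ∀ (S : Type u) [CommRing S] [Algebra K S] (m : M.obj S), h.toTensor S m =
      (LinearMap.inl K V W).baseChange S (f.toTensor S m) +
        (LinearMap.inr K V W).baseChange S (g.toTensor S m) := fun S _ _ m => rfl
  have hcomp : ∀ (S : Type u) [CommRing S] [Algebra K S] {U U' U'' : Type u} [AddCommGroup U]
      [Module K U] [AddCommGroup U'] [Module K U'] [AddCommGroup U''] [Module K U'']
      (a : U' →ₗ[K] U'') (b : U →ₗ[K] U') (x : S ⊗[K] U),
      a.baseChange S (b.baseChange S x) = (a ∘ₗ b).baseChange S x := by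
    intro S _ _ U U' U'' _ _ _ _ _ _ a b x
    rw [LinearMap.baseChange_comp, LinearMap.comp_apply]
  refine ⟨⟨h.ker, isQuasiCoherent_quotient_ker p hp h⟩, fun S _ _ m hm => ?_, fun S _ _ m hm => ?_⟩
  · have h0 : h.toTensor S m = 0 := hm
    have := congrArg ((LinearMap.fst K V W).baseChange S) ((hh S m).symm.trans h0)
    rw [map_add, map_zero, hcomp, hcomp,
      LinearMap.fst_comp_inl, LinearMap.fst_comp_inr, LinearMap.baseChange_id,
      LinearMap.baseChange_zero, LinearMap.zero_apply, add_zero] at this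
    exact (hf S m).mpr this
  · have h0 : h.toTensor S m = 0 := hm
    have := congrArg ((LinearMap.snd K V W).baseChange S) ((hh S m).symm.trans h0)
    rw [map_add, map_zero, hcomp, hcomp,
      LinearMap.snd_comp_inl, LinearMap.snd_comp_inr, LinearMap.baseChange_id,
      LinearMap.baseChange_zero, LinearMap.zero_apply, zero_add] at this
    exact (hg S m).mpr this

/-- A quasi-coherent quotient of the image of a dual functor is determined by its kernel
over `K`. -/
theorem QuasiCoherentQuotient.le_of_carrier_le (p : Hom N.dual M)
    (hp : ∀ (S : Type u) [CommRing S] [Algebra K S], Function.Surjective (p.app S))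
    {i j : M.QuasiCoherentQuotient} (h : j.ker.carrier K ≤ i.ker.carrier K) : i ≤ j := by
  intro S _ _ m hm
  obtain ⟨V, _, _, f, hf⟩ := i.exists_toTensor
  obtain ⟨W, _, _, g, hg⟩ := j.exists_toTensor
  obtain ⟨d, rfl⟩ := hp S m
  rw [hf]
  refine toTensor_eq_zero (f.comp p) d fun l => (hf K _).mp (h ((hg K _).mpr ?_))
  have := toTensor_pullForm_comp (g.comp p) (inflate d) LinearMap.id l
  rw [pullForm_inflate, LinearMap.comp_id] at this
  refine this.trans ?_
  have h0 : (g.comp p).toTensor S d = 0 := (hg S _).mp hm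
  rw [h0, map_zero]

end Image

/-! ### The double dual and the limit of the quasi-coherent quotients -/

section Limit

variable {K : Type u} [Field K] {M : ModuleFunctor.{u, u} K}

/-- The projection of `M` onto a quasi-coherent quotient. -/
def QuasiCoherentQuotient.proj (i : M.QuasiCoherentQuotient) : Hom M (M.quotient i.ker) :=
  M.quotientMap i.ker

theorem QuasiCoherentQuotient.proj_surjective (i : M.QuasiCoherentQuotient) (S : Type u)
    [CommRing S] [Algebra K S] : Function.Surjective (i.proj.app S) :=
  M.quotientMap_surjective i.ker S

theorem QuasiCoherentQuotient.isReflexive (i : M.QuasiCoherentQuotient) :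
    (M.quotient i.ker).IsReflexive :=
  i.isQuasiCoherent.isReflexive

/-- The projection `M** → (M/N)** ≅ M/N` for a quasi-coherent quotient `M/N`. -/
noncomputable def QuasiCoherentQuotient.doubleDualProj (i : M.QuasiCoherentQuotient) :
    Hom M.dual.dual (M.quotient i.ker) :=
  ((M.quotient i.ker).toDoubleDual.inv i.isReflexive).comp (dualMap (dualMap i.proj))

theorem QuasiCoherentQuotient.toDoubleDual_doubleDualProj (i : M.QuasiCoherentQuotient)
    {S : Type u} [CommRing S] [Algebra K S] (β : M.dual.dual.obj S) :
    (M.quotient i.ker).toDoubleDual.app S (i.doubleDualProj.app S β) =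
      (dualMap (dualMap i.proj)).app S β :=
  Hom.app_inv_app _ i.isReflexive S _

/-- Evaluation of `β ∈ M**(S)` at a form that factors through a quasi-coherent quotient. -/
theorem QuasiCoherentQuotient.dualEval_dualMap_proj (i : M.QuasiCoherentQuotient)
    {S : Type u} [CommRing S] [Algebra K S] (β : M.dual.dual.obj S) (T : Type u) [CommRing T]
    [Algebra K T] (f : S →ₐ[K] T) (q : (M.quotient i.ker).dual.obj T) :
    dualEval β T f ((dualMap i.proj).app T q) =
      dualEval q T (AlgHom.id K T) ((M.quotient i.ker).map f (i.doubleDualProj.app S β)) := by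
  rw [← dualEval_toDoubleDual, i.toDoubleDual_doubleDualProj, dualEval_dualMap]

/-- The projection `M/N → M/N'` for quasi-coherent quotients with `N ⊆ N'`. -/
def QuasiCoherentQuotient.transition {i j : M.QuasiCoherentQuotient} (h : i ≤ j) :
    Hom (M.quotient j.ker) (M.quotient i.ker) :=
  M.quotientSystem.trans h

theorem QuasiCoherentQuotient.transition_doubleDualProj {i j : M.QuasiCoherentQuotient}
    (h : i ≤ j) (S : Type u) [CommRing S] [Algebra K S] (β : M.dual.dual.obj S) :
    (transition h).app S (j.doubleDualProj.app S β) = i.doubleDualProj.app S β := by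
  apply (i.isReflexive S).1
  refine dual_ext fun T _ _ f q => ?_
  rw [dualEval_toDoubleDual, dualEval_toDoubleDual, ← i.dualEval_dualMap_proj β T f q,
    ← (transition h).naturality]
  exact (j.dualEval_dualMap_proj β T f ((dualMap (transition h)).app T q)).symm

/-- The morphism `M** → lim M/N` over the quasi-coherent quotients `M/N`. -/
noncomputable def doubleDualToLimit (M : ModuleFunctor.{u, u} K) :
    Hom M.dual.dual M.quotientSystem.limit where
  app S _ _ :=
    { toFun := fun β => ⟨fun i => i.doubleDualProj.app S β, fun _ _ h =>
        QuasiCoherentQuotient.transition_doubleDualProj h S β⟩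
      map_add' := fun _ _ => Subtype.ext (funext fun _ => map_add _ _ _)
      map_smul' := fun s β => Subtype.ext (funext fun i => (i.doubleDualProj.app S).map_smul s β) }
  naturality f β := Subtype.ext (funext fun i => i.doubleDualProj.naturality f β)

theorem doubleDualToLimit_toDoubleDual (S : Type u) [CommRing S] [Algebra K S] (m : M.obj S) :
    M.doubleDualToLimit.app S (M.toDoubleDual.app S m) = M.toQuotientLimit.app S m := by
  refine Subtype.ext (funext fun i => ?_)
  apply (i.isReflexive S).1
  change (M.quotient i.ker).toDoubleDual.app S
    (i.doubleDualProj.app S (M.toDoubleDual.app S m)) = _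
  rw [i.toDoubleDual_doubleDualProj, ← toDoubleDual_naturality]
  rfl

variable {N : ModuleFunctor.{u, v} K}

/-- If `M` is the image of a dual functor, then every form on `M` factors through a quasi-coherent
quotient, namely through the image of the morphism `M → 𝓢` corresponding to the form. -/
theorem exists_dualMap_proj_eq (p : Hom N.dual M)
    (hp : ∀ (S : Type u) [CommRing S] [Algebra K S], Function.Surjective (p.app S))
    {S : Type u} [CommRing S] [Algebra K S] (w : M.dual.obj S) :
    ∃ (i : M.QuasiCoherentQuotient) (q : (M.quotient i.ker).dual.obj S),
      (dualMap i.proj).app S q = w :=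
  ⟨⟨(inflate w).ker, isQuasiCoherent_quotient_ker p hp (inflate w)⟩,
    pullForm (inflate w).kerLift LinearMap.id, pullForm_inflate w⟩

theorem doubleDualToLimit_injective (p : Hom N.dual M)
    (hp : ∀ (S : Type u) [CommRing S] [Algebra K S], Function.Surjective (p.app S))
    (S : Type u) [CommRing S] [Algebra K S] : Function.Injective (M.doubleDualToLimit.app S) := by
  intro β β' h
  refine dual_ext fun T _ _ f w => ?_
  obtain ⟨i, q, rfl⟩ := exists_dualMap_proj_eq p hp w
  have hi : i.doubleDualProj.app S β = i.doubleDualProj.app S β' :=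
    congrFun (congrArg Subtype.val h) i
  rw [i.dualEval_dualMap_proj, i.dualEval_dualMap_proj, hi]

theorem doubleDualToLimit_surjective (p : Hom N.dual M)
    (hp : ∀ (S : Type u) [CommRing S] [Algebra K S], Function.Surjective (p.app S))
    (S : Type u) [CommRing S] [Algebra K S] : Function.Surjective (M.doubleDualToLimit.app S) := by
  intro x
  let c : ∀ i : M.QuasiCoherentQuotient, (M.quotient i.ker).obj S := x.1
  have hc : ∀ {i j : M.QuasiCoherentQuotient} (h : i ≤ j),
      (QuasiCoherentQuotient.transition h).app S (c j) = c i := fun {i j} h => x.2 i j h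
  -- the value of the compatible family `x` at a form on the quotient `i`
  let val : ∀ (T : Type u) [CommRing T] [Algebra K T] (_ : S →ₐ[K] T)
      (i : M.QuasiCoherentQuotient), (M.quotient i.ker).dual.obj T →ₗ[T] T :=
    fun T _ _ f i => ((M.quotient i.ker).pairing T).flip ((M.quotient i.ker).map f (c i))
  have val_le : ∀ (T : Type u) [CommRing T] [Algebra K T] (f : S →ₐ[K] T)
      {i k : M.QuasiCoherentQuotient} (h : i ≤ k) (q : (M.quotient i.ker).dual.obj T),
      val T f k ((dualMap (QuasiCoherentQuotient.transition h)).app T q) = val T f i q := by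
    intro T _ _ f i k h q
    change dualEval q T (AlgHom.id K T) ((QuasiCoherentQuotient.transition h).app T
      ((M.quotient k.ker).map f (c k))) = _
    rw [(QuasiCoherentQuotient.transition h).naturality, hc h]
    rfl
  have val_eq : ∀ (T : Type u) [CommRing T] [Algebra K T] (f : S →ₐ[K] T)
      (i j : M.QuasiCoherentQuotient) (q : (M.quotient i.ker).dual.obj T)
      (q' : (M.quotient j.ker).dual.obj T),
      (dualMap i.proj).app T q = (dualMap j.proj).app T q' → val T f i q = val T f j q' := by
    intro T _ _ f i j q q' h
    obtain ⟨k, hi, hj⟩ := directed_quasiCoherentQuotient p hp i j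
    rw [← val_le T f hi, ← val_le T f hj]
    exact congrArg _ (dualMap_injective k.proj k.proj_surjective h)
  -- each form `w` on `M` comes from a form on some quotient `ind w`; the choice does not matter
  -- because of `val_eq`
  choose ind form hform using fun (T : Type u) (_ : CommRing T) (_ : Algebra K T)
    (w : M.dual.obj T) => exists_dualMap_proj_eq p hp w
  let β : M.dual.dual.obj S := dualMk
    (fun T _ _ f =>
      { toFun := fun w => val T f (ind T _ _ w) (form T _ _ w)
        map_add' := fun w w' => by
          obtain ⟨k, h1, h2⟩ := directed_quasiCoherentQuotient p hp (ind T _ _ w) (ind T _ _ w')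
          rw [← val_le T f h1, ← val_le T f h2, ← map_add]
          refine val_eq T f _ _ _ _ ?_
          rw [hform, map_add]
          exact congrArg₂ (· + ·) (hform T _ _ w).symm (hform T _ _ w').symm
        map_smul' := fun t w => by
          rw [RingHom.id_apply, ← LinearMap.map_smul]
          refine val_eq T f _ _ _ _ ?_
          rw [hform, LinearMap.map_smul, hform] })
    (fun {T T'} _ _ _ _ f g w => by
      have h1 : val T' (g.comp f) (ind T _ _ w)
          ((M.quotient (ind T _ _ w).ker).dual.map g (form T _ _ w)) =
          g (val T f (ind T _ _ w) (form T _ _ w)) := by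
        change (M.quotient _).pairing T' _ ((M.quotient _).map (g.comp f) _) = _
        rw [ModuleFunctor.map_comp]
        exact (M.quotient _).pairing_map g _ _
      refine Eq.trans (val_eq T' _ _ _ _ _ ?_) h1
      rw [hform, (dualMap _).naturality, hform])
  refine ⟨β, Subtype.ext (funext fun i => ?_)⟩
  apply (i.isReflexive S).1
  refine dual_ext fun T _ _ f q => ?_
  change dualEval ((M.quotient i.ker).toDoubleDual.app S (i.doubleDualProj.app S β)) T f q = _
  rw [i.toDoubleDual_doubleDualProj]
  exact val_eq T f _ _ _ _ (hform T _ _ _)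

theorem doubleDualToLimit_bijective (p : Hom N.dual M)
    (hp : ∀ (S : Type u) [CommRing S] [Algebra K S], Function.Surjective (p.app S))
    (S : Type u) [CommRing S] [Algebra K S] : Function.Bijective (M.doubleDualToLimit.app S) :=
  ⟨doubleDualToLimit_injective p hp S, doubleDualToLimit_surjective p hp S⟩

theorem IsReflexive.isLimitOfQuasiCoherentQuotients (hM : M.IsReflexive) :
    M.IsLimitOfQuasiCoherentQuotients := by
  intro S _ _
  have h : ⇑(M.toQuotientLimit.app S) = M.doubleDualToLimit.app S ∘ M.toDoubleDual.app S :=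
    funext fun m => (doubleDualToLimit_toDoubleDual S m).symm
  rw [h]
  refine (doubleDualToLimit_bijective (M.toDoubleDual.inv hM) (fun T _ _ m => ?_) S).comp (hM S)
  exact ⟨_, M.toDoubleDual.inv_app_app hM T m⟩

theorem IsLimitOfQuasiCoherentQuotients.isReflexive (hM : M.IsLimitOfQuasiCoherentQuotients) :
    M.IsReflexive := by
  intro S _ _
  have h : M.doubleDualToLimit.app S ∘ M.toDoubleDual.app S = ⇑(M.toQuotientLimit.app S) :=
    funext fun m => doubleDualToLimit_toDoubleDual S m
  refine (Function.Bijective.of_comp_iff' (doubleDualToLimit_bijective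
    ((M.toQuotientLimit.inv hM).comp M.doubleDualToLimit) (fun T _ _ m => ?_) S) _).mp (h ▸ hM S)
  refine ⟨M.toDoubleDual.app T m, ?_⟩
  exact (congrArg ((M.toQuotientLimit.inv hM).app T) (doubleDualToLimit_toDoubleDual T m)).trans
    (M.toQuotientLimit.inv_app_app hM T m)

end Limit

/-! ### Reflexive functors are proquasi-coherent -/

section ProquasiCoherent

variable {K : Type u} [Field K] {M : ModuleFunctor.{u, u} K}

/-- The zero quotient. -/
theorem nonempty_quasiCoherentQuotient (M : ModuleFunctor.{u, u} K) :
    Nonempty M.QuasiCoherentQuotient := by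
  let N : M.Sub := ⟨fun _ _ _ => ⊤, fun _ _ _ => Submodule.mem_top⟩
  have hN : ∀ (S : Type u) [CommRing S] [Algebra K S], Subsingleton ((M.quotient N).obj S) :=
    fun S _ _ => Submodule.Quotient.subsingleton_iff.mpr rfl
  have hV : ∀ (S : Type u) [CommRing S] [Algebra K S],
      Subsingleton ((quasiCoherent K PUnit.{u + 1}).obj S) :=
    fun S _ _ => inferInstanceAs (Subsingleton (S ⊗[K] PUnit.{u + 1}))
  exact ⟨N, PUnit, inferInstance, inferInstance,
    { app := fun _ _ _ => 0
      naturality := fun {S T} _ _ _ _ f m => (hV T).elim _ _ },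
    fun S _ _ => ⟨fun x y _ => (hN S).elim x y, fun y => ⟨0, (hV S).elim _ _⟩⟩⟩

/-- The quasi-coherent quotients form a class that may be larger than the universe of `K`, but for
reflexive `M` they are determined by their kernels over `K`, so they can be indexed by a set of
subspaces of `M(K)`. -/
theorem IsReflexive.isProquasiCoherent (hM : M.IsReflexive) : M.IsProquasiCoherent := by
  have hsurj : ∀ (S : Type u) [CommRing S] [Algebra K S],
      Function.Surjective ((M.toDoubleDual.inv hM).app S) :=
    fun S _ _ m => ⟨_, M.toDoubleDual.inv_app_app hM S m⟩
  let I : Type u := {L : (Submodule K (M.obj K))ᵒᵈ //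
    ∃ i : M.QuasiCoherentQuotient, i.ker.carrier K = OrderDual.ofDual L}
  let Q : I → M.QuasiCoherentQuotient := fun a => a.2.choose
  have hQ : ∀ a : I, (Q a).ker.carrier K = OrderDual.ofDual a.1 := fun a => a.2.choose_spec
  have Q_le : ∀ {a b : I}, a ≤ b → Q a ≤ Q b := fun {a b} h =>
    QuasiCoherentQuotient.le_of_carrier_le _ hsurj (by rw [hQ, hQ]; exact h)
  have le_Q : ∀ {a b : I}, Q a ≤ Q b → a ≤ b := fun {a b} h => by
    have := h K
    rw [hQ, hQ] at this
    exact this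
  let idx : M.QuasiCoherentQuotient → I := fun i => ⟨OrderDual.toDual (i.ker.carrier K), i, rfl⟩
  have Q_idx_le : ∀ i, Q (idx i) ≤ i := fun i =>
    QuasiCoherentQuotient.le_of_carrier_le _ hsurj (hQ (idx i)).ge
  have le_Q_idx : ∀ i, i ≤ Q (idx i) := fun i =>
    QuasiCoherentQuotient.le_of_carrier_le _ hsurj (hQ (idx i)).le
  let F : InverseSystem.{u, u, u} K I :=
    { obj := fun a => M.quotientSystem.obj (Q a)
      trans := fun h => M.quotientSystem.trans (Q_le h)
      trans_refl := fun a S _ _ x => M.quotientSystem.trans_refl (Q a) S x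
      trans_trans := fun hij hjk S _ _ x =>
        M.quotientSystem.trans_trans (Q_le hij) (Q_le hjk) S x }
  let φ : Hom M F.limit :=
    { app := fun S _ _ =>
        { toFun := fun m => ⟨fun a => (Q a).proj.app S m, fun _ _ _ => rfl⟩
          map_add' := fun _ _ => rfl
          map_smul' := fun _ _ => rfl }
      naturality := fun _ _ => rfl }
  have hlim := hM.isLimitOfQuasiCoherentQuotients
  have hdir : IsDirected I (· ≤ ·) := ⟨fun a b => by
    obtain ⟨k, h1, h2⟩ := directed_quasiCoherentQuotient _ hsurj (Q a) (Q b)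
    exact ⟨idx k, le_Q (h1.trans (le_Q_idx k)), le_Q (h2.trans (le_Q_idx k))⟩⟩
  refine ⟨I, inferInstance, (nonempty_quasiCoherentQuotient M).map idx, hdir, F, φ,
    fun a => (Q a).isQuasiCoherent, fun S _ _ => ⟨fun m m' h => ?_, fun x => ?_⟩⟩
  · refine (hlim S).1 (Subtype.ext (funext fun i => ?_))
    have h1 : (Q (idx i)).proj.app S m = (Q (idx i)).proj.app S m' :=
      congrFun (congrArg Subtype.val h) (idx i)
    exact congrArg ((M.quotientSystem.trans (le_Q_idx i)).app S) h1
  · -- extend `x` to all quotients, each of which is equivalent to one indexed by `I`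
    let y : M.quotientSystem.limit.obj S :=
      ⟨fun i => (M.quotientSystem.trans (le_Q_idx i)).app S (x.1 (idx i)), fun i j h => by
        have h1 : idx i ≤ idx j := le_Q ((Q_idx_le i).trans (h.trans (le_Q_idx j)))
        refine Eq.trans ?_ (congrArg ((M.quotientSystem.trans (le_Q_idx i)).app S) (x.2 _ _ h1))
        exact (M.quotientSystem.trans_trans h (le_Q_idx j) S _).trans
          (M.quotientSystem.trans_trans (le_Q_idx i) (Q_le h1) S _).symm⟩
    obtain ⟨m, hm⟩ := (hlim S).2 y
    refine ⟨m, Subtype.ext (funext fun a => ?_)⟩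
    have h1 : (Q a).proj.app S m = y.1 (Q a) := congrFun (congrArg Subtype.val hm) (Q a)
    exact h1.trans (x.2 _ _ (le_Q (le_Q_idx (Q a))))

end ProquasiCoherent

end ModuleFunctor

theorem mainTheorem1 {K : Type u} [Field K] (M : ModuleFunctor.{u, u} K) :
    (M.IsReflexive ↔ M.IsLimitOfQuasiCoherentQuotients) ∧
      (M.IsReflexive → M.IsProquasiCoherent) :=
  ⟨⟨ModuleFunctor.IsReflexive.isLimitOfQuasiCoherentQuotients,
    ModuleFunctor.IsLimitOfQuasiCoherentQuotients.isReflexive⟩,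
    ModuleFunctor.IsReflexive.isProquasiCoherent⟩
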